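/- Let $n\ge 0$ and $T\in\mathrm{GL}(n,\mathbb Q)$, and let $\mathcal C_{\mathbb Z}=\{A\in\mathrm{GL}(n,\mathbb Z) : AT=TA\}$ be the centralizer of $T$ in $\mathrm{GL}(n,\mathbb Z)$. The eigenvalues and Jordan blocks of $T$ are those of its Jordan normal form over the algebraic closure $\overline{\mathbb Q}$, with the blocks counted with multiplicity. (a) If $T$ has a unique Jordan block for every eigenvalue, then $\mathcal C_{\mathbb Z}$ is abelian. (b) If $T$ has two Jordan blocks of the same size for the same eigenvalue, then $\mathcal C_{\mathbb Z}$ contains a free group on two generators, that is, a subgroup isomorphic to the free group of rank $2$. (c) If, for each eigenvalue of $T$, the Jordan blocks for that eigenvalue have pairwise different sizes, and at least one eigenvalue has several (at least two) Jordan blocks, then $\mathcal C_{\mathbb Z}$ is polycyclic, that is, it has a finite series of subgroups $1=H_0\trianglelefteq H_1\trianglelefteq\dots\trianglelefteq H_m=\mathcal C_{\mathbb Z}$ with every quotient $H_{i+1}/H_i$ cyclic. -/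

import Mathlib

open scoped MatrixGroups

/-- The upper triangular Jordan block of size `r` with eigenvalue `a`:
`a` on the diagonal and `1` on the superdiagonal. -/
def jordanBlock {K : Type*} [Field K] (a : K) (r : ℕ) : Matrix (Fin r) (Fin r) K :=
  Matrix.of fun i j => if i = j then a else if (i : ℕ) + 1 = (j : ℕ) then 1 else 0

/-- The Jordan blocks of `M` over `K` are, counted with multiplicity, the blocks of size `size i ≥ 1`
with eigenvalue `eig i`, for `i < k`: for some invertible `V`, the matrix `V * M * V⁻¹` is the block
diagonal matrix formed by these blocks (`e` numbers the rows and columns of the latter by `Fin n`). -/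
def IsJordanNormalForm {K : Type*} [Field K] {n k : ℕ} (M : Matrix (Fin n) (Fin n) K)
    (eig : Fin k → K) (size : Fin k → ℕ) : Prop :=
  (∀ i, 1 ≤ size i) ∧
    ∃ (e : (Σ i : Fin k, Fin (size i)) ≃ Fin n) (V : GL (Fin n) K),
      (V : Matrix (Fin n) (Fin n) K) * M * ((V⁻¹ : GL (Fin n) K) : Matrix (Fin n) (Fin n) K) =
        Matrix.reindex e e (Matrix.blockDiagonal' fun i => jordanBlock (eig i) (size i))

/-- A rational matrix, viewed as a matrix over the algebraic closure of `ℚ`. -/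
noncomputable def overAlgClosure {n : ℕ} (T : GL (Fin n) ℚ) :
    Matrix (Fin n) (Fin n) (AlgebraicClosure ℚ) :=
  (T : Matrix (Fin n) (Fin n) ℚ).map (algebraMap ℚ (AlgebraicClosure ℚ))

/-- Every eigenvalue of `T` has a single Jordan block. -/
def HasUniqueJordanBlocks {n : ℕ} (T : GL (Fin n) ℚ) : Prop :=
  ∃ (k : ℕ) (eig : Fin k → AlgebraicClosure ℚ) (size : Fin k → ℕ),
    IsJordanNormalForm (overAlgClosure T) eig size ∧
      ∀ i j, i ≠ j → eig i ≠ eig j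

/-- Some eigenvalue of `T` has two Jordan blocks of the same size. -/
def HasTwoEqualJordanBlocks {n : ℕ} (T : GL (Fin n) ℚ) : Prop :=
  ∃ (k : ℕ) (eig : Fin k → AlgebraicClosure ℚ) (size : Fin k → ℕ),
    IsJordanNormalForm (overAlgClosure T) eig size ∧
      ∃ i j, i ≠ j ∧ eig i = eig j ∧ size i = size j

/-- The Jordan blocks of `T` for any one eigenvalue have pairwise different sizes, and at least one
eigenvalue has several Jordan blocks. -/
def HasSeveralDistinctJordanBlocks {n : ℕ} (T : GL (Fin n) ℚ) : Prop :=
  ∃ (k : ℕ) (eig : Fin k → AlgebraicClosure ℚ) (size : Fin k → ℕ),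
    IsJordanNormalForm (overAlgClosure T) eig size ∧
      (∀ i j, i ≠ j → eig i = eig j → size i ≠ size j) ∧
      ∃ i j, i ≠ j ∧ eig i = eig j

/-- The integral centralizer of `T`: all `A ∈ GL(n, ℤ)` that commute with `T` in `GL(n, ℚ)`. -/
def integralCentralizer {n : ℕ} (T : GL (Fin n) ℚ) : Subgroup (GL (Fin n) ℤ) :=
  (Subgroup.centralizer {T}).comap (Matrix.GeneralLinearGroup.map (Int.castRingHom ℚ))

/-- A group is polycyclic if it has a finite series `1 = H 0 ≤ H 1 ≤ ⋯ ≤ H m = G` of subgroups, each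
normal in the next one, with cyclic successive quotients. -/
def IsPolycyclic (G : Type*) [Group G] : Prop :=
  ∃ (m : ℕ) (H : ℕ → Subgroup G), H 0 = ⊥ ∧ H m = ⊤ ∧
    ∀ i < m, H i ≤ H (i + 1) ∧
      ∃ _ : ((H i).subgroupOf (H (i + 1))).Normal,
        IsCyclic (H (i + 1) ⧸ (H i).subgroupOf (H (i + 1)))

/-!
Over the algebraic closure, a matrix `X` commuting with the Jordan matrix `J` has no block between
different eigenvalues, and its blocks between equal eigenvalues are constant along diagonals, with
zeros forced by the filtrations by kernels and by images of the powers of `J - λ`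
(`blockEntry_eq_zero_of_eig_ne`, `blockEntry_succ_succ`, `blockEntry_eq_zero_of_lt`,
`blockEntry_eq_zero_of_size_lt`).

If every eigenvalue has a single block, reflecting the blocks in their antidiagonals is an
anti-automorphism fixing the whole centralizer of `J`, which is therefore commutative
(`commute_of_commute_jordanMatrix`).

If the blocks of each eigenvalue have different sizes, the centralizer of `J` is triangular for a
weight on the basis (`apply_eq_zero_of_commute`). For an integral group that becomes triangular over
the algebraic numbers, the diagonal entries are units of the ring of integers of a number field, so
they form a finitely generated abelian group by Dirichlet's theorem. The kernel is filtered by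
congruences modulo higher and higher weight, with quotients that embed in quotients of the additive
group of integral matrices. Hence the group is polycyclic (`isPolycyclic_of_weightTriangular`).

If an eigenvalue has two blocks of equal size, matrix units have to be found over `ℚ`. Decompose
`ℚ ^ n`, as a module over `ℚ[X]`, into cyclic modules `ℚ[X] ⧸ (p ^ e)`. When two non-zero summands
are isomorphic, exchanging them gives `E`, `F` commuting with `T` such that `E² = F² = 0` and
`E F E = E ≠ 0`; for suitable integers `m₁, m₂ ≥ 3` the matrices `1 + m₁ E` and `1 + m₂ F` are
integral, act on a plane as transverse shears, and generate a free group by ping-pong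
(`exists_injective_freeGroup_of_matrixUnits`). Otherwise the diagonal blocks of an endomorphism are
multiplicative modulo nilpotents, so `tr ((A B - B A) D) = 0` on the centralizer of `T`
(`exists_matrixUnits_or_trace_eq_zero`). This identity is multilinear and the centralizer over the
algebraic closure is spanned by the rational one, so it persists over the algebraic closure
(`Matrix.trace_commutator_mul_eq_zero_of_map`), where the two equal blocks violate it
(`exists_trace_commutator_mul_ne_zero`).
-/

/-! ### Endomorphisms of sums of primary cyclic modules -/

/-- A linear map between cyclic modules is multiplication by a lift of the image of `1`. -/
theorem LinearMap.quotient_span_apply {R : Type*} [CommRing R] {x y : R}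
    (f : (R ⧸ Submodule.span R {x}) →ₗ[R] R ⧸ Submodule.span R {y}) :
    ∃ a : R, ∀ r : R, f (Submodule.Quotient.mk r) = Submodule.Quotient.mk (r * a) := by
  obtain ⟨a, ha⟩ := Submodule.Quotient.mk_surjective _ (f (Submodule.Quotient.mk 1))
  refine ⟨a, fun r => ?_⟩
  have h : (Submodule.Quotient.mk r : R ⧸ Submodule.span R {x})
      = r • Submodule.Quotient.mk 1 := by
    rw [← Submodule.Quotient.mk_smul, smul_eq_mul, mul_one]
  rw [h, map_smul, ← ha, ← Submodule.Quotient.mk_smul, smul_eq_mul]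

theorem LinearMap.commute_end_quotient_span {R : Type*} [CommRing R] {x : R}
    (f g : Module.End R (R ⧸ Submodule.span R {x})) : Commute f g := by
  obtain ⟨a, ha⟩ := LinearMap.quotient_span_apply f
  obtain ⟨b, hb⟩ := LinearMap.quotient_span_apply g
  refine LinearMap.ext fun r => ?_
  obtain ⟨r, rfl⟩ := Submodule.Quotient.mk_surjective _ r
  simp only [Module.End.mul_apply, ha, hb]
  congr 1
  ring

/-- A composite `R ⧸ p ^ d → R ⧸ q ^ e → R ⧸ p ^ d` is multiplication by some `a * b`. If `p` does
not divide `a * b`, then `p ^ d` and `q ^ e` divide each other. -/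
theorem LinearMap.isNilpotent_comp_of_span_ne {R : Type*} [CommRing R] [IsDomain R]
    [IsPrincipalIdealRing R] {p q : R} (hp : Irreducible p) (hq : Irreducible q) {d e : ℕ}
    (hne : Submodule.span R {p ^ d} ≠ Submodule.span R {q ^ e})
    (f : (R ⧸ Submodule.span R {p ^ d}) →ₗ[R] R ⧸ Submodule.span R {q ^ e})
    (g : (R ⧸ Submodule.span R {q ^ e}) →ₗ[R] R ⧸ Submodule.span R {p ^ d}) :
    IsNilpotent (g ∘ₗ f : Module.End R (R ⧸ Submodule.span R {p ^ d})) := by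
  obtain ⟨a, ha⟩ := LinearMap.quotient_span_apply f
  obtain ⟨b, hb⟩ := LinearMap.quotient_span_apply g
  have hpow : ∀ (k : ℕ) (r : R), ((g ∘ₗ f : Module.End R _) ^ k)
      (Submodule.Quotient.mk r : R ⧸ Submodule.span R {p ^ d})
        = Submodule.Quotient.mk (r * (a * b) ^ k) := by
    intro k
    induction k with
    | zero => intro r; simp
    | succ k ih =>
      intro r
      rw [pow_succ, Module.End.mul_apply, LinearMap.comp_apply, ha, hb, ih]
      congr 1
      ring
  have hnil : p ∣ a * b → IsNilpotent (g ∘ₗ f : Module.End R (R ⧸ Submodule.span R {p ^ d})) := by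
    intro h
    refine ⟨d, LinearMap.ext fun r => ?_⟩
    obtain ⟨r, rfl⟩ := Submodule.Quotient.mk_surjective _ r
    rw [hpow, LinearMap.zero_apply, Submodule.Quotient.mk_eq_zero]
    exact Ideal.mem_span_singleton.mpr ((pow_dvd_pow_of_dvd h d).mul_left r)
  rcases Nat.eq_zero_or_pos d with rfl | hd
  · refine ⟨1, LinearMap.ext fun r => ?_⟩
    obtain ⟨r, rfl⟩ := Submodule.Quotient.mk_surjective _ r
    rw [hpow, LinearMap.zero_apply, Submodule.Quotient.mk_eq_zero]
    exact Ideal.mem_span_singleton.mpr (by simp)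
  by_contra hcon
  have hab : ¬ p ∣ a * b := fun h => hcon (hnil h)
  have h1 : q ^ e ∣ p ^ d * a := by
    have h := ha (p ^ d)
    rw [(Submodule.Quotient.mk_eq_zero _).mpr (Submodule.mem_span_singleton_self _), map_zero,
      eq_comm, Submodule.Quotient.mk_eq_zero] at h
    exact Ideal.mem_span_singleton.mp h
  have h2 : p ^ d ∣ q ^ e * b := by
    have h := hb (q ^ e)
    rw [(Submodule.Quotient.mk_eq_zero _).mpr (Submodule.mem_span_singleton_self _), map_zero,
      eq_comm, Submodule.Quotient.mk_eq_zero] at h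
    exact Ideal.mem_span_singleton.mp h
  have h3 : p ^ d ∣ q ^ e :=
    hp.prime.pow_dvd_of_dvd_mul_right d (fun h => hab (h.mul_left a)) h2
  have hpq : p ∣ q := hp.prime.dvd_of_dvd_pow ((dvd_pow_self p hd.ne').trans h3)
  have h4 : q ^ e ∣ p ^ d :=
    hq.prime.pow_dvd_of_dvd_mul_right e (fun h => hab ((hpq.trans h).mul_right b)) h1
  exact hne (Ideal.span_singleton_eq_span_singleton.mpr (associated_of_dvd_dvd h3 h4))

/-- If the diagonal blocks of the endomorphism ring have commuting elements and every product of two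
opposite off-diagonal blocks is nilpotent, then taking a diagonal block is multiplicative modulo
nilpotents. -/
theorem isNilpotent_block_mul_sub {R M ι : Type*} {N : ι → Type*} [CommRing R] [AddCommGroup M]
    [Module R M] [∀ i, AddCommGroup (N i)] [∀ i, Module R (N i)] [Fintype ι] [DecidableEq ι]
    (pr : ∀ i, M →ₗ[R] N i) (inj : ∀ i, N i →ₗ[R] M) (hid : ∑ i, inj i ∘ₗ pr i = LinearMap.id)
    {i : ι} (hcomm : ∀ f g : Module.End R (N i), Commute f g)
    (hnil : ∀ j, j ≠ i → ∀ (f : N i →ₗ[R] N j) (g : N j →ₗ[R] N i),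
      IsNilpotent (g ∘ₗ f : Module.End R (N i)))
    (f g : Module.End R M) :
    IsNilpotent ((pr i ∘ₗ (f * g) ∘ₗ inj i) - (pr i ∘ₗ f ∘ₗ inj i) * (pr i ∘ₗ g ∘ₗ inj i) :
      Module.End R (N i)) := by
  have h : (pr i ∘ₗ (f * g) ∘ₗ inj i : Module.End R (N i))
      = ∑ j, (pr i ∘ₗ f ∘ₗ inj j) ∘ₗ (pr j ∘ₗ g ∘ₗ inj i) := by
    refine LinearMap.ext fun x => ?_
    have hx := LinearMap.congr_fun hid (g (inj i x))
    simp only [LinearMap.sum_apply, LinearMap.comp_apply, LinearMap.id_apply] at hx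
    simp only [LinearMap.sum_apply, LinearMap.comp_apply, Module.End.mul_apply]
    conv_lhs => rw [← hx]
    rw [map_sum, map_sum]
  rw [h, ← Finset.add_sum_erase _ _ (Finset.mem_univ i), Module.End.mul_eq_comp,
    add_sub_cancel_left]
  refine Commute.isNilpotent_sum (fun j hj => hnil j (Finset.ne_of_mem_erase hj) _ _)
    (fun j k _ _ => hcomm _ _)

theorem isNilpotent_block_commutator_mul {R M ι : Type*} {N : ι → Type*} [CommRing R]
    [AddCommGroup M]
    [Module R M] [∀ i, AddCommGroup (N i)] [∀ i, Module R (N i)] [Fintype ι] [DecidableEq ι]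
    (pr : ∀ i, M →ₗ[R] N i) (inj : ∀ i, N i →ₗ[R] M) (hid : ∑ i, inj i ∘ₗ pr i = LinearMap.id)
    {i : ι} (hcomm : ∀ f g : Module.End R (N i), Commute f g)
    (hnil : ∀ j, j ≠ i → ∀ (f : N i →ₗ[R] N j) (g : N j →ₗ[R] N i),
      IsNilpotent (g ∘ₗ f : Module.End R (N i)))
    (f g h : Module.End R M) :
    IsNilpotent (pr i ∘ₗ ((f * g - g * f) * h) ∘ₗ inj i : Module.End R (N i)) := by
  have key := isNilpotent_block_mul_sub pr inj hid hcomm hnil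
  have h1 : IsNilpotent (pr i ∘ₗ (f * g - g * f) ∘ₗ inj i : Module.End R (N i)) := by
    have h2 := (hcomm _ _).isNilpotent_sub (key f g) (key g f)
    rw [(hcomm (pr i ∘ₗ f ∘ₗ inj i) (pr i ∘ₗ g ∘ₗ inj i)).eq, sub_sub_sub_cancel_right] at h2
    rwa [LinearMap.sub_comp, LinearMap.comp_sub]
  have h3 := (hcomm _ _).isNilpotent_add (key (f * g - g * f) h)
    ((hcomm _ (pr i ∘ₗ h ∘ₗ inj i)).isNilpotent_mul_right h1)
  rwa [sub_add_cancel] at h3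

theorem LinearMap.isNilpotent_restrictScalars {F R M : Type*} [CommRing F] [CommRing R]
    [Algebra F R] [AddCommGroup M] [Module R M] [Module F M] [IsScalarTower F R M]
    {f : Module.End R M} (hf : IsNilpotent f) :
    IsNilpotent (f.restrictScalars F : Module.End F M) := by
  obtain ⟨k, hk⟩ := hf
  refine ⟨k, LinearMap.ext fun x => ?_⟩
  have h : ∀ j : ℕ, ((f.restrictScalars F : Module.End F M) ^ j) x = (f ^ j) x := by
    intro j
    induction j with
    | zero => rfl
    | succ j ih => rw [pow_succ', pow_succ', Module.End.mul_apply, Module.End.mul_apply, ih]; rfl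
  rw [h, hk]; rfl

/-- If no two of the summands `R ⧸ (p i ^ e i)` are isomorphic, the trace form kills commutators. -/
theorem trace_commutator_mul_eq_zero_of_span_ne {F R M ι : Type*} [Field F] [CommRing R]
    [IsDomain R] [IsPrincipalIdealRing R] [Algebra F R] [AddCommGroup M] [Module R M] [Module F M]
    [IsScalarTower F R M] [Module.Finite F M] [Fintype ι] {p : ι → R} (hp : ∀ i, Irreducible (p i))
    (e : ι → ℕ) (φ : M ≃ₗ[R] ∀ i, R ⧸ Submodule.span R {p i ^ e i})
    (hne : ∀ i j, i ≠ j → Submodule.span R {p i ^ e i} = Submodule.span R {p j ^ e j} →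
      Submodule.span R {p i ^ e i} = ⊤)
    (f g h : Module.End R M) :
    LinearMap.trace F M (((f * g - g * f) * h).restrictScalars F) = 0 := by
  classical
  let pr : ∀ i, M →ₗ[R] R ⧸ Submodule.span R {p i ^ e i} :=
    fun i => LinearMap.proj i ∘ₗ φ.toLinearMap
  let inj : ∀ i, (R ⧸ Submodule.span R {p i ^ e i}) →ₗ[R] M :=
    fun i => φ.symm.toLinearMap ∘ₗ LinearMap.single R (fun i => R ⧸ Submodule.span R {p i ^ e i}) i
  have hid : ∑ i, inj i ∘ₗ pr i = LinearMap.id := by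
    refine LinearMap.ext fun x => φ.injective ?_
    rw [LinearMap.sum_apply, map_sum]
    simp only [inj, pr, LinearMap.comp_apply, LinearEquiv.coe_coe, LinearEquiv.apply_symm_apply,
      LinearMap.id_apply, LinearMap.proj_apply, LinearMap.single_apply]
    exact Finset.univ_sum_single (φ x)
  have hone : ∀ i, pr i ∘ₗ inj i = LinearMap.id := by
    intro i
    refine LinearMap.ext fun x => ?_
    simp [pr, inj]
  set k := (f * g - g * f) * h with hk
  have hfin : ∀ i, Module.Finite F (R ⧸ Submodule.span R {p i ^ e i}) := fun i =>
    Module.Finite.of_surjective ((pr i).restrictScalars F)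
      (Function.LeftInverse.surjective (g := inj i) fun x => LinearMap.congr_fun (hone i) x)
  have hsum : k.restrictScalars F
      = ∑ i, (k ∘ₗ inj i).restrictScalars F ∘ₗ (pr i).restrictScalars F := by
    refine LinearMap.ext fun x => ?_
    have hx := LinearMap.congr_fun hid x
    simp only [LinearMap.sum_apply, LinearMap.comp_apply, LinearMap.id_apply] at hx
    simp only [LinearMap.sum_apply, LinearMap.comp_apply, LinearMap.restrictScalars_apply]
    conv_lhs => rw [← hx]
    rw [map_sum]
  rw [hsum, map_sum]
  refine Finset.sum_eq_zero fun i _ => ?_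
  rw [LinearMap.trace_comp_comm']
  have hnil : IsNilpotent (pr i ∘ₗ k ∘ₗ inj i : Module.End R _) := by
    by_cases htop : Submodule.span R {p i ^ e i} = ⊤
    · have : Subsingleton (R ⧸ Submodule.span R {p i ^ e i}) :=
        Submodule.Quotient.subsingleton_iff.mpr htop
      exact ⟨1, Subsingleton.elim _ _⟩
    · exact isNilpotent_block_commutator_mul pr inj hid LinearMap.commute_end_quotient_span
        (fun j hj f g => LinearMap.isNilpotent_comp_of_span_ne (hp i) (hp j)
          (fun h => htop (hne i j hj.symm h)) f g) f g h
  exact (LinearMap.isNilpotent_trace_of_isNilpotent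
    (LinearMap.isNilpotent_restrictScalars (F := F) hnil)).eq_zero

/-- Two isomorphic non-zero summands give a pair of "matrix units" exchanging them. -/
theorem exists_matrixUnits_of_summands_equiv {R M ι : Type*} [CommRing R] [AddCommGroup M]
    [Module R M] {N : ι → Type*} [∀ i, AddCommGroup (N i)] [∀ i, Module R (N i)]
    (φ : M ≃ₗ[R] ∀ i, N i) {i j : ι} (hij : i ≠ j) (θ : N i ≃ₗ[R] N j) [Nontrivial (N i)] :
    ∃ E F : Module.End R M, E * E = 0 ∧ F * F = 0 ∧ E * F * E = E ∧ E ≠ 0 := by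
  classical
  let pr : ∀ i, M →ₗ[R] N i := fun i => LinearMap.proj i ∘ₗ φ.toLinearMap
  let inj : ∀ i, N i →ₗ[R] M := fun i => φ.symm.toLinearMap ∘ₗ LinearMap.single R _ i
  have hone : ∀ i x, pr i (inj i x) = x := by
    intro i x
    simp [pr, inj]
  have hzero : ∀ i j, i ≠ j → ∀ x, pr i (inj j x) = 0 := by
    intro i j h x
    simp [pr, inj, h]
  refine ⟨inj j ∘ₗ θ.toLinearMap ∘ₗ pr i, inj i ∘ₗ θ.symm.toLinearMap ∘ₗ pr j,
    LinearMap.ext fun x => ?_, LinearMap.ext fun x => ?_, LinearMap.ext fun x => ?_,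
    fun h => ?_⟩
  · simp [hzero i j hij]
  · simp [hzero j i hij.symm]
  · simp [hone]
  · obtain ⟨x, hx⟩ := exists_ne (0 : N i)
    have h1 := congrArg (pr j) (LinearMap.congr_fun h (inj i x))
    simp [hone] at h1
    exact hx h1

/-! ### The centralizer of a matrix over the ground field -/

open Polynomial in
/-- The `F[X]`-linear endomorphisms of `F ^ n`, where `X` acts as `T`, are the matrices commuting
with `T`; the trace is the one over `F`. -/
theorem exists_ringHom_end_aeval_centralizer {F : Type*} [Field F] {n : ℕ}
    (T : Matrix (Fin n) (Fin n) F) :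
    ∃ Ψ : Module.End F[X] (Module.AEval' (Matrix.toLin' T)) →+* Matrix (Fin n) (Fin n) F,
      Function.Injective Ψ ∧ (∀ f, Commute (Ψ f) T) ∧ (∀ A, Commute A T → ∃ f, Ψ f = A) ∧
      ∀ f, (Ψ f).trace
        = LinearMap.trace F (Module.AEval' (Matrix.toLin' T)) (f.restrictScalars F) := by
  let o := Module.AEval'.of (Matrix.toLin' T)
  let Ψ : Module.End F[X] (Module.AEval' (Matrix.toLin' T)) →+* Matrix (Fin n) (Fin n) F :=
    { toFun := fun f => LinearMap.toMatrix' (o.symm.conj (f.restrictScalars F))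
      map_one' := by
        rw [← LinearMap.toMatrix'_one]
        congr 1
      map_zero' := by
        rw [← map_zero LinearMap.toMatrix']
        congr 1
      map_add' := fun f g => by
        rw [← map_add, ← map_add]
        rfl
      map_mul' := fun f g => by
        rw [← LinearMap.toMatrix'_mul]
        congr 1 }
  have hΨ : ∀ f, Ψ f = LinearMap.toMatrix' (o.symm.conj (f.restrictScalars F)) := fun f => rfl
  refine ⟨Ψ, fun f g hfg => ?_, fun f => ?_, fun A hA => ?_, fun f => ?_⟩
  · have h := o.symm.conj.injective (LinearMap.toMatrix'.injective hfg)
    exact LinearMap.restrictScalars_injective F h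
  · have h : o.symm.conj (f.restrictScalars F) * Matrix.toLin' T
        = Matrix.toLin' T * o.symm.conj (f.restrictScalars F) := by
      refine LinearMap.ext fun x => ?_
      simp only [Module.End.mul_apply, LinearEquiv.conj_apply, LinearMap.comp_apply,
        LinearEquiv.coe_coe, LinearMap.restrictScalars_apply, LinearEquiv.symm_symm]
      rw [← Module.AEval'.X_smul_of, map_smul, Module.AEval'.of_symm_X_smul]
    have h' := congrArg LinearMap.toMatrix' h
    rwa [LinearMap.toMatrix'_mul, LinearMap.toMatrix'_mul, LinearMap.toMatrix'_toLin'] at h'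
  · refine ⟨LinearMap.ofAEval _ (o.toLinearMap ∘ₗ Matrix.toLin' A) fun x => ?_, ?_⟩
    · have h : A.mulVec (T.mulVec x) = T.mulVec (A.mulVec x) := by
        rw [Matrix.mulVec_mulVec, Matrix.mulVec_mulVec, hA.eq]
      change o (A.mulVec (T.mulVec x)) = (X : F[X]) • o (A.mulVec x)
      rw [Module.AEval'.X_smul_of, h]
      rfl
    · rw [hΨ]
      conv_rhs => rw [← LinearMap.toMatrix'_toLin' A]
      congr 1
  · rw [hΨ, ← LinearMap.trace_conj' _ o.symm, ← Matrix.trace_toLin'_eq,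
      Matrix.toLin'_toMatrix']

/-- Rational dichotomy: either the centralizer of `T` contains a pair of matrix units exchanging two
isomorphic summands of the `F[X]`-module defined by `T`, or the trace form of the centralizer
vanishes on commutators. -/
theorem exists_matrixUnits_or_trace_eq_zero {F : Type*} [Field F] {n : ℕ}
    (T : Matrix (Fin n) (Fin n) F) :
    (∃ E G : Matrix (Fin n) (Fin n) F, Commute E T ∧ Commute G T ∧
      E * E = 0 ∧ G * G = 0 ∧ E * G * E = E ∧ E ≠ 0) ∨
    ∀ A B D : Matrix (Fin n) (Fin n) F, Commute A T → Commute B T → Commute D T →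
      ((A * B - B * A) * D).trace = 0 := by
  classical
  obtain ⟨Ψ, hinj, hcomm, hsurj, htr⟩ := exists_ringHom_end_aeval_centralizer T
  have htors : Module.IsTorsion (Polynomial F) (Module.AEval' (Matrix.toLin' T)) :=
    Module.AEval.isTorsion_of_finiteDimensional F _ _
  obtain ⟨ι, _, p, hp, e, ⟨φ₀⟩⟩ := Module.equiv_directSum_of_isTorsion htors
  let φ := φ₀.trans (DirectSum.linearEquivFunOnFintype _ ι _)
  by_cases h : ∃ i j, i ≠ j ∧
      Submodule.span (Polynomial F) {p i ^ e i} = Submodule.span (Polynomial F) {p j ^ e j} ∧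
      Submodule.span (Polynomial F) {p i ^ e i} ≠ ⊤
  · left
    obtain ⟨i, j, hij, hs, htop⟩ := h
    have : Nontrivial (Polynomial F ⧸ Submodule.span (Polynomial F) {p i ^ e i}) :=
      Submodule.Quotient.nontrivial_iff.mpr htop
    obtain ⟨E, G, h1, h2, h3, h4⟩ := exists_matrixUnits_of_summands_equiv φ hij
      (Submodule.quotEquivOfEq _ _ hs)
    refine ⟨Ψ E, Ψ G, hcomm E, hcomm G, ?_, ?_, ?_, ?_⟩
    · rw [← map_mul, h1, map_zero]
    · rw [← map_mul, h2, map_zero]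
    · rw [← map_mul, ← map_mul, h3]
    · exact fun h => h4 (hinj (h.trans (map_zero Ψ).symm))
  · right
    intro A B D hA hB hD
    obtain ⟨f, rfl⟩ := hsurj A hA
    obtain ⟨g, rfl⟩ := hsurj B hB
    obtain ⟨k, rfl⟩ := hsurj D hD
    rw [← map_mul, ← map_mul, ← map_sub, ← map_mul, htr]
    refine trace_commutator_mul_eq_zero_of_span_ne hp e φ (fun i j hij hs => ?_) f g k
    by_contra htop
    exact h ⟨i, j, hij, hs, htop⟩

/-! ### Extension of scalars -/

/-- Commuting with a matrix over `F` is a linear condition over `F`, so its solutions over an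
extension are spanned by those over `F`. -/
theorem Matrix.mem_span_map_commute {F K : Type*} [Field F] [Field K] [Algebra F K] {n : ℕ}
    (T : Matrix (Fin n) (Fin n) F) {X : Matrix (Fin n) (Fin n) K}
    (hX : Commute X (T.map (algebraMap F K))) :
    X ∈ Submodule.span K {Y | ∃ A, Commute A T ∧ Y = A.map (algebraMap F K)} := by
  classical
  let b := Module.Basis.ofVectorSpace F K
  -- the matrix of `b k`-coordinates of the entries of `X`
  let C : _ → Matrix (Fin n) (Fin n) F := fun k => X.map fun x => b.repr x k
  have hC : ∀ k, Commute (C k) T := by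
    intro k
    ext i j
    have h := congrArg (fun x => b.repr x k) (congrFun (congrFun hX.eq i) j)
    simp only [Matrix.mul_apply, Matrix.map_apply, map_sum, Finsupp.coe_finsetSum,
      Finset.sum_apply] at h
    simp only [Matrix.mul_apply, C, Matrix.map_apply]
    convert h using 2 with l _ l _
    · rw [mul_comm (X i l), ← Algebra.smul_def, map_smul, Finsupp.smul_apply, smul_eq_mul, mul_comm]
    · rw [← Algebra.smul_def, map_smul, Finsupp.smul_apply, smul_eq_mul]
  let s : Finset _ :=
    Finset.univ.biUnion fun i => Finset.univ.biUnion fun j => (b.repr (X i j)).support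
  have hX' : X = ∑ k ∈ s, b k • (C k).map (algebraMap F K) := by
    ext i j
    rw [Matrix.sum_apply]
    conv_lhs => rw [← b.linearCombination_repr (X i j), Finsupp.linearCombination_apply]
    rw [Finsupp.sum_of_support_subset (s := s)]
    · refine Finset.sum_congr rfl fun k _ => ?_
      simp [C, Algebra.smul_def, mul_comm]
    · exact fun k hk => Finset.mem_biUnion.mpr ⟨i, Finset.mem_univ _,
        Finset.mem_biUnion.mpr ⟨j, Finset.mem_univ _, hk⟩⟩
    · simp
  rw [hX']
  exact Submodule.sum_mem _ fun k _ =>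
    Submodule.smul_mem _ _ (Submodule.subset_span ⟨C k, hC k, rfl⟩)

/-- The vanishing of the trace form on commutators is multilinear, hence passes to extensions. -/
theorem Matrix.trace_commutator_mul_eq_zero_of_map {F K : Type*} [Field F] [Field K] [Algebra F K]
    {n : ℕ} (T : Matrix (Fin n) (Fin n) F)
    (h : ∀ A B D : Matrix (Fin n) (Fin n) F, Commute A T → Commute B T → Commute D T →
      ((A * B - B * A) * D).trace = 0)
    {A B D : Matrix (Fin n) (Fin n) K} (hA : Commute A (T.map (algebraMap F K)))
    (hB : Commute B (T.map (algebraMap F K))) (hD : Commute D (T.map (algebraMap F K))) :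
    ((A * B - B * A) * D).trace = 0 := by
  replace hA := Matrix.mem_span_map_commute T hA
  replace hB := Matrix.mem_span_map_commute T hB
  replace hD := Matrix.mem_span_map_commute T hD
  induction hA using Submodule.span_induction with
  | zero => simp
  | add x y _ _ hx hy =>
    have : ((x + y) * B - B * (x + y)) * D = (x * B - B * x) * D + (y * B - B * y) * D := by
      noncomm_ring
    rw [this, Matrix.trace_add, hx, hy, add_zero]
  | smul c x _ hx =>
    rw [Matrix.smul_mul, Matrix.mul_smul, ← smul_sub, Matrix.smul_mul, Matrix.trace_smul, hx,
      smul_zero]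
  | mem x hx =>
    obtain ⟨A, hA, rfl⟩ := hx
    induction hB using Submodule.span_induction with
    | zero => simp
    | add x y _ _ hx hy =>
      have : ∀ Z : Matrix (Fin n) (Fin n) K,
          (Z * (x + y) - (x + y) * Z) * D = (Z * x - x * Z) * D + (Z * y - y * Z) * D := by
        intro Z; noncomm_ring
      rw [this, Matrix.trace_add, hx, hy, add_zero]
    | smul c x _ hx =>
      rw [Matrix.smul_mul, Matrix.mul_smul, ← smul_sub, Matrix.smul_mul, Matrix.trace_smul, hx,
        smul_zero]
    | mem x hx =>
      obtain ⟨B, hB, rfl⟩ := hx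
      induction hD using Submodule.span_induction with
      | zero => simp
      | add x y _ _ hx hy => rw [mul_add, Matrix.trace_add, hx, hy, add_zero]
      | smul c x _ hx => rw [Matrix.mul_smul, Matrix.trace_smul, hx, smul_zero]
      | mem x hx =>
        obtain ⟨D, hD, rfl⟩ := hx
        have h1 := congrArg (algebraMap F K) (h A B D hA hB hD)
        rw [map_zero, AddMonoidHom.map_trace] at h1
        simpa [Matrix.map_mul, Matrix.map_sub] using h1

/-! ### Matrices commuting with a Jordan matrix -/

/-- The block diagonal matrix formed by the Jordan blocks of sizes `size i` and eigenvalues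
`eig i`. -/
abbrev jordanMatrix {K : Type*} [Field K] {k : ℕ} (eig : Fin k → K) (size : Fin k → ℕ) :
    Matrix (Σ i, Fin (size i)) (Σ i, Fin (size i)) K :=
  Matrix.blockDiagonal' fun i => jordanBlock (eig i) (size i)

section JordanMatrix

variable {K : Type*} [Field K] {k : ℕ} {eig : Fin k → K} {size : Fin k → ℕ}

theorem jordanMatrix_apply (p q : Σ i, Fin (size i)) :
    jordanMatrix eig size p q = (if p = q then eig q.1 else 0) +
      if p.1 = q.1 ∧ (p.2 : ℕ) + 1 = q.2 then 1 else 0 := by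
  obtain ⟨i, a⟩ := p
  obtain ⟨j, b⟩ := q
  by_cases h : i = j
  · subst h
    rw [jordanMatrix, Matrix.blockDiagonal'_apply_eq, jordanBlock, Matrix.of_apply]
    by_cases hab : a = b
    · subst hab; simp
    · simp [hab]
  · rw [jordanMatrix, Matrix.blockDiagonal'_apply_ne _ _ _ h]
    simp [h]

/-- The entries of the block `(i, j)` of `X`, extended by zero to all natural indices. -/
noncomputable def blockEntry (X : Matrix (Σ i, Fin (size i)) (Σ i, Fin (size i)) K) (i j : Fin k)
    (a b : ℕ) : K :=
  if h : a < size i ∧ b < size j then X ⟨i, a, h.1⟩ ⟨j, b, h.2⟩ else 0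

theorem blockEntry_eq (X : Matrix (Σ i, Fin (size i)) (Σ i, Fin (size i)) K)
    (p q : Σ i, Fin (size i)) : X p q = blockEntry X p.1 q.1 p.2 q.2 := by
  simp [blockEntry]

theorem blockEntry_of_le (X : Matrix (Σ i, Fin (size i)) (Σ i, Fin (size i)) K) {i : Fin k}
    (j : Fin k) {a : ℕ} (h : size i ≤ a) (b : ℕ) : blockEntry X i j a b = 0 :=
  dif_neg fun h' => by omega

/-- The equation `X J = J X`, read off at one entry. -/
theorem blockEntry_of_commute {X : Matrix (Σ i, Fin (size i)) (Σ i, Fin (size i)) K}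
    (hX : Commute X (jordanMatrix eig size)) {i j : Fin k} {a b : ℕ} (ha : a < size i)
    (hb : b < size j) :
    blockEntry X i j a b * eig j + (if b = 0 then 0 else blockEntry X i j a (b - 1)) =
      eig i * blockEntry X i j a b + blockEntry X i j (a + 1) b := by
  have h := congrFun (congrFun hX.eq ⟨i, a, ha⟩) ⟨j, b, hb⟩
  rw [Matrix.mul_apply, Matrix.mul_apply] at h
  simp only [jordanMatrix_apply, mul_add, add_mul, Finset.sum_add_distrib, mul_ite, ite_mul,
    mul_zero, zero_mul, mul_one, one_mul, Finset.sum_ite_eq, Finset.sum_ite_eq', Finset.mem_univ,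
    if_true] at h
  have h1 : blockEntry X i j a b = X ⟨i, a, ha⟩ ⟨j, b, hb⟩ := dif_pos ⟨ha, hb⟩
  rw [h1]
  convert h using 2
  · split_ifs with hb0
    · symm
      refine Finset.sum_eq_zero fun r _ => if_neg ?_
      rintro ⟨-, h3⟩
      omega
    · rw [Finset.sum_eq_single (⟨j, b - 1, by omega⟩ : Σ i, Fin (size i))]
      · rw [if_pos ⟨rfl, by simp only; omega⟩]
        exact dif_pos ⟨ha, by omega⟩
      · rintro ⟨j', c⟩ - hne
        refine if_neg ?_
        rintro ⟨h2, h3⟩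
        simp only at h2 h3
        subst h2
        refine hne ?_
        congr 1
        ext
        simp only
        omega
      · exact fun h => absurd (Finset.mem_univ _) h
  · by_cases ha' : a + 1 < size i
    · rw [Finset.sum_eq_single (⟨i, a + 1, ha'⟩ : Σ i, Fin (size i))]
      · rw [if_pos ⟨rfl, rfl⟩]
        exact dif_pos ⟨ha', hb⟩
      · rintro ⟨j', c⟩ - hne
        refine if_neg ?_
        rintro ⟨h2, h3⟩
        simp only at h2 h3
        subst h2
        refine hne ?_
        congr 1
        ext
        simp only
        omega
      · exact fun h => absurd (Finset.mem_univ _) h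
    · rw [blockEntry_of_le X j (by omega)]
      symm
      refine Finset.sum_eq_zero fun r _ => if_neg ?_
      rintro ⟨h2, h3⟩
      obtain ⟨i', c⟩ := r
      simp only at h2 h3
      subst h2
      omega

variable {X Y : Matrix (Σ i, Fin (size i)) (Σ i, Fin (size i)) K}

theorem blockEntry_eq_zero_of_eig_ne (hX : Commute X (jordanMatrix eig size)) {i j : Fin k}
    (hij : eig i ≠ eig j) (a b : ℕ) : blockEntry X i j a b = 0 := by
  -- the equation at `(a, b)` expresses the entry through those at `(a, b - 1)` and `(a + 1, b)`
  induction hm : b + (size i - a) using Nat.strong_induction_on generalizing a b with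
  | _ m ih =>
    by_cases hab : a < size i ∧ b < size j
    · have h := blockEntry_of_commute hX hab.1 hab.2
      rw [ih _ (by omega) (a + 1) b rfl] at h
      have h2 : (if b = 0 then 0 else blockEntry X i j a (b - 1)) = 0 := by
        split_ifs with hb
        · rfl
        · exact ih _ (by omega) a (b - 1) rfl
      rw [h2] at h
      have h3 : (eig j - eig i) * blockEntry X i j a b = 0 := by linear_combination h
      exact (mul_eq_zero.mp h3).resolve_left (sub_ne_zero.mpr hij.symm)
    · exact dif_neg hab

theorem blockEntry_succ_zero (hX : Commute X (jordanMatrix eig size)) {i j : Fin k}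
    (hij : eig i = eig j) (a : ℕ) : blockEntry X i j (a + 1) 0 = 0 := by
  by_cases hab : a < size i ∧ 0 < size j
  · have h := blockEntry_of_commute hX hab.1 hab.2
    rw [if_pos rfl, hij] at h
    linear_combination -h
  · exact dif_neg fun h => hab ⟨by omega, h.2⟩

/-- Blocks between equal eigenvalues are constant along diagonals. -/
theorem blockEntry_succ_succ (hX : Commute X (jordanMatrix eig size)) {i j : Fin k}
    (hij : eig i = eig j) {a b : ℕ} (ha : a < size i) (hb : b + 1 < size j) :
    blockEntry X i j (a + 1) (b + 1) = blockEntry X i j a b := by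
  have h := blockEntry_of_commute hX ha hb
  rw [if_neg (Nat.succ_ne_zero b), hij, Nat.add_sub_cancel] at h
  linear_combination -h

/-- `X` cannot increase the height in the kernel filtration of `J - eig i`. -/
theorem blockEntry_eq_zero_of_lt (hX : Commute X (jordanMatrix eig size)) {i j : Fin k}
    (hij : eig i = eig j) {a b : ℕ} (hab : b < a) : blockEntry X i j a b = 0 := by
  induction b generalizing a with
  | zero =>
    obtain ⟨a, rfl⟩ := Nat.exists_eq_succ_of_ne_zero hab.ne'
    exact blockEntry_succ_zero hX hij a
  | succ b ih =>
    obtain ⟨a, rfl⟩ := Nat.exists_eq_succ_of_ne_zero (Nat.ne_zero_of_lt hab)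
    by_cases h : a + 1 < size i ∧ b + 1 < size j
    · rw [Nat.succ_eq_add_one, blockEntry_succ_succ hX hij (by omega) h.2]
      exact ih (by omega)
    · exact dif_neg h

/-- `X` cannot decrease the depth in the image filtration of `J - eig i`. -/
theorem blockEntry_eq_zero_of_size_lt (hX : Commute X (jordanMatrix eig size)) {i j : Fin k}
    (hij : eig i = eig j) {a b : ℕ} (hab : size i + b < size j + a) :
    blockEntry X i j a b = 0 := by
  induction hm : size i - a generalizing a b with
  | zero => exact blockEntry_of_le X j (by omega) b
  | succ m ih =>
    rw [← blockEntry_succ_succ hX hij (by omega) (by omega)]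
    exact ih (by omega) (by omega)

theorem blockEntry_add (hX : Commute X (jordanMatrix eig size)) {i j : Fin k}
    (hij : eig i = eig j) (a d : ℕ) (ha : a < size i) (hd : a + d < size j) :
    blockEntry X i j a (a + d) = blockEntry X i j 0 d := by
  induction a with
  | zero => rw [Nat.zero_add]
  | succ a ih =>
    have h : a + 1 + d = a + d + 1 := by omega
    rw [h, blockEntry_succ_succ hX hij (by omega) (by omega), ih (by omega) (by omega)]

/-- If the eigenvalues of the blocks are pairwise different, a matrix commuting with the Jordan
matrix is unchanged by reflecting all its blocks in their antidiagonals. -/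
theorem apply_rev_rev_of_commute (hX : Commute X (jordanMatrix eig size))
    (heig : ∀ i j, i ≠ j → eig i ≠ eig j) (p q : Σ i, Fin (size i)) :
    X ⟨q.1, q.2.rev⟩ ⟨p.1, p.2.rev⟩ = X p q := by
  obtain ⟨i, a⟩ := p
  obtain ⟨j, b⟩ := q
  rw [blockEntry_eq X ⟨j, _⟩, blockEntry_eq X ⟨i, a⟩]
  by_cases hij : i = j
  · subst hij
    simp only [Fin.val_rev]
    have ha := a.isLt
    have hb := b.isLt
    rcases lt_or_ge (b : ℕ) a with hab | hab
    · rw [blockEntry_eq_zero_of_lt hX rfl hab, blockEntry_eq_zero_of_lt hX rfl (by omega)]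
    · obtain ⟨d, hd⟩ := Nat.exists_eq_add_of_le hab
      have h : size i - (a + 1) = size i - (b + 1) + d := by omega
      rw [h, hd, blockEntry_add hX rfl _ _ (by omega) (by omega),
        blockEntry_add hX rfl _ _ (by omega) (by omega)]
  · rw [blockEntry_eq_zero_of_eig_ne hX (heig i j hij),
      blockEntry_eq_zero_of_eig_ne hX (heig j i (Ne.symm hij))]

/-- The reflection in the antidiagonals reverses products but fixes everything that commutes with
the Jordan matrix. -/
theorem commute_of_commute_jordanMatrix (hX : Commute X (jordanMatrix eig size))
    (hY : Commute Y (jordanMatrix eig size)) (heig : ∀ i j, i ≠ j → eig i ≠ eig j) :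
    Commute X Y := by
  refine Matrix.ext fun p q => ?_
  let ρ : (Σ i, Fin (size i)) ≃ Σ i, Fin (size i) := Equiv.sigmaCongrRight fun _ => Fin.revPerm
  have hρ : ∀ p, ρ p = ⟨p.1, p.2.rev⟩ := fun p => rfl
  rw [← apply_rev_rev_of_commute (hX.mul_left hY) heig p q, ← hρ, ← hρ, Matrix.mul_apply,
    Matrix.mul_apply, ← Equiv.sum_comp ρ]
  refine Finset.sum_congr rfl fun r _ => ?_
  rw [hρ, hρ, hρ, apply_rev_rev_of_commute hX heig, apply_rev_rev_of_commute hY heig, mul_comm]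

/-- If blocks with the same eigenvalue have different sizes, the matrices commuting with the Jordan
matrix are triangular for the weight `size - 2 * index`, which is, up to a constant, the depth minus
the height of a basis vector: both contributions weakly increase, and they are stationary together
only on the diagonal. -/
theorem apply_eq_zero_of_commute (hX : Commute X (jordanMatrix eig size))
    (hsize : ∀ i j, i ≠ j → eig i = eig j → size i ≠ size j) {p q : Σ i, Fin (size i)}
    (hpq : p ≠ q) (h : (size p.1 : ℤ) - 2 * (p.2 : ℕ) ≤ (size q.1 : ℤ) - 2 * (q.2 : ℕ)) :
    X p q = 0 := by
  rw [blockEntry_eq X]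
  by_cases heig : eig p.1 = eig q.1
  swap
  · exact blockEntry_eq_zero_of_eig_ne hX heig _ _
  rcases lt_or_ge (q.2 : ℕ) p.2 with h1 | h1
  · exact blockEntry_eq_zero_of_lt hX heig h1
  rcases lt_or_ge (size p.1 + q.2) (size q.1 + p.2) with h2 | h2
  · exact blockEntry_eq_zero_of_size_lt hX heig h2
  exfalso
  obtain ⟨i, a⟩ := p
  obtain ⟨j, b⟩ := q
  simp only at h h1 h2 heig
  by_cases hij : i = j
  · subst hij
    exact hpq (by congr 1; ext; omega)
  · exact hsize i j hij heig (by omega)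

/-- Two equal blocks give commuting matrices on which the trace form does not vanish: the
permutation exchanging the blocks and the projection to one of them generate a full
algebra of `2 × 2` matrices. -/
theorem exists_trace_commutator_mul_ne_zero [CharZero K] {i j : Fin k} (hij : i ≠ j)
    (heig : eig i = eig j) (hsize : size i = size j) (hpos : 1 ≤ size i) :
    ∃ A B D : Matrix (Σ i, Fin (size i)) (Σ i, Fin (size i)) K,
      Commute A (jordanMatrix eig size) ∧ Commute B (jordanMatrix eig size) ∧
      Commute D (jordanMatrix eig size) ∧ ((A * B - B * A) * D).trace ≠ 0 := by
  have hsw : ∀ l, size l = size (Equiv.swap i j l) := by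
    intro l
    rcases eq_or_ne l i with rfl | hi
    · rw [Equiv.swap_apply_left, hsize]
    rcases eq_or_ne l j with rfl | hj
    · rw [Equiv.swap_apply_right, hsize]
    rw [Equiv.swap_apply_of_ne_of_ne hi hj]
  have hsw' : ∀ l, eig (Equiv.swap i j l) = eig l := by
    intro l
    rcases eq_or_ne l i with rfl | hi
    · rw [Equiv.swap_apply_left, heig]
    rcases eq_or_ne l j with rfl | hj
    · rw [Equiv.swap_apply_right, heig]
    rw [Equiv.swap_apply_of_ne_of_ne hi hj]
  let σ : (Σ i, Fin (size i)) ≃ Σ i, Fin (size i) :=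
    Equiv.sigmaCongr (Equiv.swap i j) fun l => finCongr (hsw l)
  have hσ1 : ∀ p, (σ p).1 = Equiv.swap i j p.1 := fun p => rfl
  have hσ2 : ∀ p, ((σ p).2 : ℕ) = p.2 := fun p => rfl
  have hσJ : ∀ p q, jordanMatrix eig size (σ p) (σ q) = jordanMatrix eig size p q := by
    intro p q
    rw [jordanMatrix_apply, jordanMatrix_apply]
    simp only [hσ1, hσ2, hsw', EmbeddingLike.apply_eq_iff_eq]
  let d : (Σ i, Fin (size i)) → K := fun p => if p.1 = i then 1 else 0
  let P : Matrix (Σ i, Fin (size i)) (Σ i, Fin (size i)) K := σ.toPEquiv.toMatrix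
  let Q : Matrix (Σ i, Fin (size i)) (Σ i, Fin (size i)) K := σ.symm.toPEquiv.toMatrix
  have hP : Commute P (jordanMatrix eig size) := by
    rw [Commute, SemiconjBy, PEquiv.toMatrix_toPEquiv_mul, PEquiv.mul_toMatrix_toPEquiv]
    ext p q
    simp only [Matrix.submatrix_apply, id]
    rw [← hσJ p (σ.symm q), Equiv.apply_symm_apply]
  have hQ : Commute Q (jordanMatrix eig size) := by
    rw [Commute, SemiconjBy, PEquiv.toMatrix_toPEquiv_mul, PEquiv.mul_toMatrix_toPEquiv]
    ext p q
    simp only [Matrix.submatrix_apply, id, Equiv.symm_symm]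
    rw [← hσJ (σ.symm p) q, Equiv.apply_symm_apply]
  have hD : Commute (Matrix.diagonal d) (jordanMatrix eig size) := by
    refine Matrix.ext fun p q => ?_
    rw [Matrix.diagonal_mul, Matrix.mul_diagonal, mul_comm]
    by_cases h : p.1 = q.1
    · simp only [d, h]
    · rw [jordanMatrix_apply, if_neg fun h' => h (congrArg _ h'), if_neg fun h' => h h'.1]
      simp
  refine ⟨P, Matrix.diagonal d * Q, Matrix.diagonal d, hP, hD.mul_left hQ, hD, ?_⟩
  have h1 : P * (Matrix.diagonal d * Q) = Matrix.diagonal (d ∘ σ) := by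
    rw [PEquiv.toMatrix_toPEquiv_mul, PEquiv.mul_toMatrix_toPEquiv, Matrix.submatrix_submatrix]
    ext p q
    simp [Matrix.diagonal_apply]
  have h2 : Matrix.diagonal d * Q * P = Matrix.diagonal d := by
    rw [PEquiv.mul_toMatrix_toPEquiv, PEquiv.mul_toMatrix_toPEquiv, Matrix.submatrix_submatrix]
    ext p q
    simp
  rw [h1, h2, Matrix.diagonal_sub, Matrix.diagonal_mul_diagonal, Matrix.trace_diagonal]
  have h3 : ∀ p, ((d ∘ σ) p - d p) * d p = -(if p.1 = i then 1 else 0) := by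
    intro p
    simp only [Function.comp_apply, d, hσ1]
    by_cases h : p.1 = i
    · simp [h, hij.symm]
    · simp [h]
  rw [Finset.sum_congr rfl fun p _ => h3 p, Finset.sum_neg_distrib, neg_ne_zero, Finset.sum_boole,
    Nat.cast_ne_zero, Finset.card_ne_zero]
  exact ⟨⟨i, 0, hpos⟩, by simp⟩

end JordanMatrix

/-- Passing to Jordan normal form is an isomorphism of matrix rings preserving the trace. -/
theorem IsJordanNormalForm.exists_ringEquiv {K : Type*} [Field K] {n k : ℕ}
    {M : Matrix (Fin n) (Fin n) K} {eig : Fin k → K} {size : Fin k → ℕ}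
    (h : IsJordanNormalForm M eig size) :
    ∃ Φ : Matrix (Fin n) (Fin n) K ≃+* Matrix (Σ i, Fin (size i)) (Σ i, Fin (size i)) K,
      Φ M = jordanMatrix eig size ∧ ∀ X, (Φ X).trace = X.trace := by
  obtain ⟨-, e, V, hV⟩ := h
  let c : Matrix (Fin n) (Fin n) K ≃+* Matrix (Fin n) (Fin n) K :=
    { toFun := fun X => V.val * X * V⁻¹.val
      invFun := fun X => V⁻¹.val * X * V.val
      left_inv := fun X => by
        simp only [mul_assoc, Units.inv_mul, mul_one, Units.inv_mul_cancel_left]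
      right_inv := fun X => by
        simp only [mul_assoc, Units.mul_inv, mul_one, Units.mul_inv_cancel_left]
      map_mul' := fun X Y => by
        simp only [mul_assoc, Units.inv_mul_cancel_left]
      map_add' := fun X Y => by rw [mul_add, add_mul] }
  refine ⟨c.trans (Matrix.reindexRingEquiv K e.symm), ?_, fun X => ?_⟩
  · change Matrix.reindex e.symm e.symm (V.val * M * V⁻¹.val) = _
    rw [hV]
    ext p q
    simp
  · change (Matrix.reindex e.symm e.symm (V.val * X * V⁻¹.val)).trace = _
    have h : (V.val * X * V⁻¹.val).trace = X.trace := by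
      rw [Matrix.trace_mul_comm, ← mul_assoc, Units.inv_mul, one_mul]
    rw [← h]
    exact Equiv.sum_comp e fun i => (V.val * X * V⁻¹.val) i i

/-! ### Free groups generated by shears -/

/-- The horizontal shear `(x, y) ↦ (x + m y, y)` on the non-zero integral vectors. -/
def shearLeft (m : ℤ) : Equiv.Perm {v : ℤ × ℤ // v ≠ 0} where
  toFun v := ⟨(v.1.1 + m * v.1.2, v.1.2), fun h => v.2 <| by
    obtain ⟨h1, h2⟩ := Prod.mk.inj h
    ext
    · simpa [h2] using h1
    · exact h2⟩
  invFun v := ⟨(v.1.1 - m * v.1.2, v.1.2), fun h => v.2 <| by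
    obtain ⟨h1, h2⟩ := Prod.mk.inj h
    ext
    · simpa [h2] using h1
    · exact h2⟩
  left_inv v := by ext <;> simp
  right_inv v := by ext <;> simp

/-- The vertical shear `(x, y) ↦ (x, y + m x)` on the non-zero integral vectors. -/
def shearRight (m : ℤ) : Equiv.Perm {v : ℤ × ℤ // v ≠ 0} where
  toFun v := ⟨(v.1.1, v.1.2 + m * v.1.1), fun h => v.2 <| by
    obtain ⟨h1, h2⟩ := Prod.mk.inj h
    ext
    · exact h1
    · simpa [h1] using h2⟩
  invFun v := ⟨(v.1.1, v.1.2 - m * v.1.1), fun h => v.2 <| by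
    obtain ⟨h1, h2⟩ := Prod.mk.inj h
    ext
    · exact h1
    · simpa [h1] using h2⟩
  left_inv v := by ext <;> simp
  right_inv v := by ext <;> simp

open scoped Pointwise in
/-- Ping-pong between the vectors close to the horizontal axis and those close to the vertical axis,
each family split according to the sign of the slope. -/
theorem injective_lift_shear {m₁ m₂ : ℤ} (h₁ : 3 ≤ m₁) (h₂ : 3 ≤ m₂) :
    Function.Injective (FreeGroup.lift ![shearLeft m₁, shearRight m₂]) := by
  let X : Fin 2 → Set {v : ℤ × ℤ // v ≠ 0} :=
    ![{v | (0 ≤ v.1.2 ∧ v.1.2 < v.1.1) ∨ (v.1.2 ≤ 0 ∧ v.1.1 < v.1.2)},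
      {v | (0 ≤ v.1.1 ∧ v.1.1 < v.1.2) ∨ (v.1.1 ≤ 0 ∧ v.1.2 < v.1.1)}]
  let Y : Fin 2 → Set {v : ℤ × ℤ // v ≠ 0} :=
    ![{v | (0 < v.1.2 ∧ v.1.1 < -v.1.2) ∨ (v.1.2 < 0 ∧ -v.1.2 < v.1.1)},
      {v | (0 < v.1.1 ∧ v.1.2 < -v.1.1) ∨ (v.1.1 < 0 ∧ -v.1.1 < v.1.2)}]
  have hmul : ∀ m y : ℤ, 3 ≤ m → (0 < y ∧ 3 * y ≤ m * y) ∨ (y < 0 ∧ m * y ≤ 3 * y) ∨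
      (y = 0 ∧ m * y = 0) := by
    intro m y hm
    rcases lt_trichotomy y 0 with hy | hy | hy
    · exact Or.inr (Or.inl ⟨hy, by nlinarith⟩)
    · exact Or.inr (Or.inr ⟨hy, by rw [hy, mul_zero]⟩)
    · exact Or.inl ⟨hy, by nlinarith⟩
  have hne : ∀ v : {v : ℤ × ℤ // v ≠ 0}, v.1.1 ≠ 0 ∨ v.1.2 ≠ 0 := by
    intro v
    by_contra! h
    exact v.2 (Prod.ext h.1 h.2)
  refine FreeGroup.injective_lift_of_ping_pong _ X Y ?_ ?_ ?_ ?_ ?_ ?_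
  · intro i
    fin_cases i
    · exact ⟨⟨(1, 0), by simp⟩, by simp [X]⟩
    · exact ⟨⟨(0, 1), by simp⟩, by simp [X]⟩
  · intro i j hij
    refine Set.disjoint_left.mpr fun v hv hv' => ?_
    fin_cases i <;> fin_cases j <;> simp [X] at hij hv hv' <;> omega
  · intro i j hij
    refine Set.disjoint_left.mpr fun v hv hv' => ?_
    fin_cases i <;> fin_cases j <;> simp [Y] at hij hv hv' <;> omega
  · intro i j
    refine Set.disjoint_left.mpr fun v hv hv' => ?_
    fin_cases i <;> fin_cases j <;> simp [X, Y] at hv hv' <;> omega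
  · intro i
    rintro _ ⟨v, hv, rfl⟩
    have hv0 := hne v
    fin_cases i
    · have := hmul m₁ v.1.2 h₁
      simp [Y] at hv
      simp [X, shearLeft]
      omega
    · have := hmul m₂ v.1.1 h₂
      simp [Y] at hv
      simp [X, shearRight]
      omega
  · intro i
    rintro _ ⟨v, hv, rfl⟩
    have hv0 := hne v
    fin_cases i
    · have := hmul m₁ v.1.2 h₁
      simp [X] at hv
      simp [Y, shearLeft, Equiv.Perm.inv_def]
      omega
    · have := hmul m₂ v.1.1 h₂
      simp [X] at hv
      simp [Y, shearRight, Equiv.Perm.inv_def]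
      omega

/-- Two group elements acting as transverse shears on the lattice spanned by `u` and `w` generate a
free group. -/
theorem injective_lift_of_shears {R G V : Type*} [CommRing R] [Group G] [AddCommGroup V]
    [Module R V] (ρ : G →* Module.End R V) {a b : G} {u w : V} {m₁ m₂ : ℤ} (h₁ : 3 ≤ m₁)
    (h₂ : 3 ≤ m₂) (hau : ρ a u = u) (haw : ρ a w = w + m₁ • u) (hbu : ρ b u = u + m₂ • w)
    (hbw : ρ b w = w) (hind : ∀ x y : ℤ, x • u + y • w = 0 → x = 0 ∧ y = 0) :
    Function.Injective (FreeGroup.lift ![a, b]) := by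
  let F := FreeGroup.lift ![shearLeft m₁, shearRight m₂]
  let vec : {v : ℤ × ℤ // v ≠ 0} → V := fun v => v.1.1 • u + v.1.2 • w
  have hvec : Function.Injective vec := by
    intro v v' h
    have h1 := hind (v.1.1 - v'.1.1) (v.1.2 - v'.1.2) (by
      have h' : v.1.1 • u + v.1.2 • w = v'.1.1 • u + v'.1.2 • w := h
      rw [sub_smul, sub_smul]
      rw [← sub_eq_zero] at h'
      rw [← h']
      abel)
    exact Subtype.ext (Prod.ext (by omega) (by omega))
  have hgen : ∀ i v, ρ (![a, b] i) (vec v) = vec ((![shearLeft m₁, shearRight m₂] i) v) := by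
    intro i v
    fin_cases i
    · change ρ a (v.1.1 • u + v.1.2 • w) = (v.1.1 + m₁ * v.1.2) • u + v.1.2 • w
      rw [map_add, map_zsmul, map_zsmul, hau, haw, smul_add, add_smul, smul_smul, mul_comm m₁]
      abel
    · change ρ b (v.1.1 • u + v.1.2 • w) = v.1.1 • u + (v.1.2 + m₂ * v.1.1) • w
      rw [map_add, map_zsmul, map_zsmul, hbu, hbw, smul_add, add_smul, smul_smul, mul_comm m₂]
      abel
  have key : ∀ g v, ρ (FreeGroup.lift ![a, b] g) (vec v) = vec (F g v) := by
    intro g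
    induction g using FreeGroup.induction_on with
    | C1 => intro v; simp
    | of i => intro v; simpa [F] using hgen i v
    | inv_of i _ =>
      intro v
      have h := hgen i ((![shearLeft m₁, shearRight m₂] i)⁻¹ v)
      rw [← Equiv.Perm.mul_apply, mul_inv_cancel, Equiv.Perm.one_apply] at h
      simp only [map_inv, FreeGroup.lift_apply_of, F]
      rw [← h, ← Module.End.mul_apply, ← map_mul, inv_mul_cancel, map_one, Module.End.one_apply]
    | mul x y hx hy =>
      intro v
      rw [map_mul, map_mul, Module.End.mul_apply, hy, hx, map_mul, Equiv.Perm.mul_apply]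
  refine (injective_iff_map_eq_one _).mpr fun g hg => ?_
  refine (injective_iff_map_eq_one _).mp (injective_lift_shear h₁ h₂) g (Equiv.ext fun v => hvec ?_)
  rw [← key, hg, map_one]
  rfl

/-! ### The integral centralizer -/

theorem commute_of_mem_integralCentralizer {n : ℕ} {T : GL (Fin n) ℚ} {A : GL (Fin n) ℤ} :
    A ∈ integralCentralizer T ↔
      Commute ((A : Matrix (Fin n) (Fin n) ℤ).map (Int.castRingHom ℚ))
        (T : Matrix (Fin n) (Fin n) ℚ) := by
  rw [integralCentralizer, Subgroup.mem_comap, Subgroup.mem_centralizer_singleton_iff,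
    ← Units.val_inj]
  exact Iff.rfl

/-- Base change followed by the passage to Jordan normal form, on integral matrices. -/
theorem IsJordanNormalForm.exists_injective_ringHom {n k : ℕ} {T : GL (Fin n) ℚ}
    {eig : Fin k → AlgebraicClosure ℚ} {size : Fin k → ℕ}
    (hJ : IsJordanNormalForm (overAlgClosure T) eig size) :
    ∃ Φ : Matrix (Fin n) (Fin n) ℤ →+*
        Matrix (Σ i, Fin (size i)) (Σ i, Fin (size i)) (AlgebraicClosure ℚ),
      Function.Injective Φ ∧
        ∀ A ∈ integralCentralizer T, Commute (Φ A.val) (jordanMatrix eig size) := by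
  obtain ⟨Φ, hΦ, -⟩ := hJ.exists_ringEquiv
  refine ⟨Φ.toRingHom.comp (((algebraMap ℚ (AlgebraicClosure ℚ)).mapMatrix).comp
    (Int.castRingHom ℚ).mapMatrix), ?_, fun A hA => ?_⟩
  · exact Φ.injective.comp
      ((Matrix.map_injective (algebraMap ℚ (AlgebraicClosure ℚ)).injective).comp
        (Matrix.map_injective (Int.castRingHom ℚ).injective_int))
  · rw [← hΦ]
    exact ((commute_of_mem_integralCentralizer.mp hA).map
      (algebraMap ℚ (AlgebraicClosure ℚ)).mapMatrix).map Φ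

theorem HasUniqueJordanBlocks.mul_comm_of_mem {n : ℕ} {T : GL (Fin n) ℚ}
    (hT : HasUniqueJordanBlocks T) {A B : GL (Fin n) ℤ} (hA : A ∈ integralCentralizer T)
    (hB : B ∈ integralCentralizer T) : A * B = B * A := by
  obtain ⟨k, eig, size, hJ, heig⟩ := hT
  obtain ⟨Φ, hinj, hcomm⟩ := hJ.exists_injective_ringHom
  refine Units.ext (hinj ?_)
  rw [Units.val_mul, Units.val_mul, map_mul, map_mul]
  exact commute_of_commute_jordanMatrix (hcomm A hA) (hcomm B hB) heig

/-! ### Two equal Jordan blocks -/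

/-- For a rational square-zero `E` commuting with `T`, a unipotent element `1 + m E` of the integral
centralizer of `T`. -/
theorem exists_unipotent_mem_integralCentralizer {n : ℕ} {T : GL (Fin n) ℚ}
    {E : Matrix (Fin n) (Fin n) ℚ} (hE : Commute E T) (hsq : E * E = 0) :
    ∃ A ∈ integralCentralizer T, ∃ m : ℤ, 3 ≤ m ∧
      (A : Matrix (Fin n) (Fin n) ℤ).map (Int.castRingHom ℚ) = 1 + m • E := by
  have hd : (0 : ℤ) < E.den := by
    have := Matrix.den_ne_zero E
    omega
  have hnum : E.num.map (Int.castRingHom ℚ) = (E.den : ℤ) • E := by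
    have hd' : (E.den : ℚ) ≠ 0 := Nat.cast_ne_zero.mpr (Matrix.den_ne_zero E)
    have h := congrArg (fun M => (E.den : ℚ) • M) (Matrix.inv_denom_smul_num E)
    simp only [smul_smul, mul_inv_cancel₀ hd', one_smul] at h
    rw [← Int.cast_smul_eq_zsmul ℚ, Int.cast_natCast, ← h]
    rfl
  have hnum2 : E.num * E.num = 0 := by
    refine Matrix.map_injective (Int.castRingHom ℚ).injective_int ?_
    beta_reduce
    rw [Matrix.map_mul, hnum, smul_mul_smul_comm, hsq, smul_zero, Matrix.map_zero _ (map_zero _)]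
  let A : GL (Fin n) ℤ := ⟨1 + 3 • E.num, 1 - 3 • E.num, by
    have : (1 + 3 • E.num) * (1 - 3 • E.num) = 1 - 9 • (E.num * E.num) := by noncomm_ring
    rw [this, hnum2, smul_zero, sub_zero], by
    have : (1 - 3 • E.num) * (1 + 3 • E.num) = 1 - 9 • (E.num * E.num) := by noncomm_ring
    rw [this, hnum2, smul_zero, sub_zero]⟩
  have hA : (A : Matrix (Fin n) (Fin n) ℤ).map (Int.castRingHom ℚ) = 1 + (3 * (E.den : ℤ)) • E := by
    change (Int.castRingHom ℚ).mapMatrix (1 + 3 • E.num) = _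
    rw [map_add, map_one, map_nsmul, RingHom.mapMatrix_apply, hnum, mul_smul]
    rfl
  refine ⟨A, commute_of_mem_integralCentralizer.mpr ?_, 3 * E.den, by omega, hA⟩
  rw [hA]
  exact (Commute.one_left _).add_left (hE.smul_left _)

/-- Rational matrix units commuting with `T` give a free group in the integral centralizer. -/
theorem exists_injective_freeGroup_of_matrixUnits {n : ℕ} {T : GL (Fin n) ℚ}
    {E F : Matrix (Fin n) (Fin n) ℚ} (hE : Commute E (T : Matrix (Fin n) (Fin n) ℚ))
    (hF : Commute F (T : Matrix (Fin n) (Fin n) ℚ)) (hEE : E * E = 0) (hFF : F * F = 0)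
    (hEFE : E * F * E = E) (hE0 : E ≠ 0) :
    ∃ f : FreeGroup (Fin 2) →* integralCentralizer T, Function.Injective f := by
  obtain ⟨A, hA, m₁, h₁, hA'⟩ := exists_unipotent_mem_integralCentralizer hE hEE
  obtain ⟨B, hB, m₂, h₂, hB'⟩ := exists_unipotent_mem_integralCentralizer hF hFF
  obtain ⟨x, hx⟩ : ∃ x, E.mulVec x ≠ 0 := by
    by_contra! h
    exact hE0 (Matrix.toLin'.injective (LinearMap.ext fun x => by simp [h]))
  let ρ : integralCentralizer T →* Module.End ℚ (Fin n → ℚ) :=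
    (Matrix.toLinAlgEquiv' (R := ℚ) (n := Fin n)).toAlgHom.toRingHom.toMonoidHom.comp
      ((Units.coeHom _).comp ((Matrix.GeneralLinearGroup.map (Int.castRingHom ℚ)).comp
        (integralCentralizer T).subtype))
  have hρ : ∀ C v, ρ C v = (C.1.1.map (Int.castRingHom ℚ)).mulVec v := fun C v => rfl
  -- the lattice spanned by `u = E x` and `w = F u`
  set u := E.mulVec x with hu
  set w := F.mulVec u with hw
  have hEu : E.mulVec u = 0 := by rw [hu, Matrix.mulVec_mulVec, hEE, Matrix.zero_mulVec]
  have hFw : F.mulVec w = 0 := by rw [hw, Matrix.mulVec_mulVec, hFF, Matrix.zero_mulVec]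
  have hEw : E.mulVec w = u := by
    rw [hw, hu, Matrix.mulVec_mulVec, Matrix.mulVec_mulVec, hEFE]
  refine ⟨_, injective_lift_of_shears ρ (a := ⟨A, hA⟩) (b := ⟨B, hB⟩) (u := u) (w := w) h₁ h₂
    ?_ ?_ ?_ ?_ fun y z h => ?_⟩
  · rw [hρ, hA', Matrix.add_mulVec, Matrix.one_mulVec, Matrix.smul_mulVec, hEu, smul_zero,
      add_zero]
  · rw [hρ, hA', Matrix.add_mulVec, Matrix.one_mulVec, Matrix.smul_mulVec, hEw]
  · rw [hρ, hB', Matrix.add_mulVec, Matrix.one_mulVec, Matrix.smul_mulVec]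
  · rw [hρ, hB', Matrix.add_mulVec, Matrix.one_mulVec, Matrix.smul_mulVec, hFw, smul_zero,
      add_zero]
  · have h1 := congrArg E.mulVec h
    rw [Matrix.mulVec_add, Matrix.mulVec_smul, Matrix.mulVec_smul, hEu, hEw, smul_zero, zero_add,
      Matrix.mulVec_zero] at h1
    have hz : z = 0 := (smul_eq_zero.mp h1).resolve_right hx
    rw [hz, zero_smul, add_zero] at h
    exact ⟨(smul_eq_zero.mp h).resolve_right hx, hz⟩

/-- If the rational centralizer contained no suitable matrix units, its trace form, and hence that
of the centralizer over the algebraic closure, would vanish on commutators; two equal Jordan blocks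
prevent this. -/
theorem HasTwoEqualJordanBlocks.exists_injective_freeGroup {n : ℕ} {T : GL (Fin n) ℚ}
    (hT : HasTwoEqualJordanBlocks T) :
    ∃ f : FreeGroup (Fin 2) →* integralCentralizer T, Function.Injective f := by
  obtain ⟨k, eig, size, hJ, i, j, hij, heig, hsize⟩ := hT
  rcases exists_matrixUnits_or_trace_eq_zero (T : Matrix (Fin n) (Fin n) ℚ) with
    ⟨E, F, hE, hF, h1, h2, h3, h4⟩ | htr
  · exact exists_injective_freeGroup_of_matrixUnits hE hF h1 h2 h3 h4
  · exfalso
    obtain ⟨Φ, hΦ, hΦtr⟩ := hJ.exists_ringEquiv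
    obtain ⟨A, B, D, hA, hB, hD, hne⟩ :=
      exists_trace_commutator_mul_ne_zero hij heig hsize (hJ.1 i)
    have hcomm : ∀ X, Commute X (jordanMatrix eig size) →
        Commute (Φ.symm X) (overAlgClosure T) := by
      intro X hX
      have h := hX.map Φ.symm
      rwa [← hΦ, RingEquiv.symm_apply_apply] at h
    refine hne ?_
    rw [← Φ.apply_symm_apply ((A * B - B * A) * D), hΦtr, map_mul, map_sub, map_mul, map_mul]
    exact Matrix.trace_commutator_mul_eq_zero_of_map _ htr (hcomm A hA) (hcomm B hB) (hcomm D hD)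

/-! ### Polycyclic series -/

section Polycyclic

variable {G : Type*} [Group G]

/-- One step of a polycyclic series: `A` is normal in `B` with cyclic quotient. -/
def CyclicStep (A B : Subgroup G) : Prop :=
  A ≤ B ∧ ∃ _ : (A.subgroupOf B).Normal, IsCyclic (B ⧸ A.subgroupOf B)

theorem exists_series_of_reflTransGen {A B : Subgroup G}
    (h : Relation.ReflTransGen CyclicStep A B) :
    ∃ (m : ℕ) (H : ℕ → Subgroup G), H 0 = A ∧ H m = B ∧ ∀ i < m, CyclicStep (H i) (H (i + 1)) := by
  induction h with
  | refl => exact ⟨0, fun _ => A, rfl, rfl, fun i hi => absurd hi (Nat.not_lt_zero i)⟩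
  | @tail B C _ hBC ih =>
    obtain ⟨m, H, h0, hm, hstep⟩ := ih
    refine ⟨m + 1, fun i => if i ≤ m then H i else C, by simp [h0], by simp, fun i hi => ?_⟩
    rcases Nat.lt_succ_iff_lt_or_eq.mp hi with hi | rfl
    · beta_reduce
      rw [if_pos hi.le, if_pos (Nat.succ_le_of_lt hi)]
      exact hstep i hi
    · beta_reduce
      rw [if_pos le_rfl, if_neg (by omega), hm]
      exact hBC

theorem isPolycyclic_of_reflTransGen (h : Relation.ReflTransGen CyclicStep (⊥ : Subgroup G) ⊤) :
    IsPolycyclic G :=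
  exists_series_of_reflTransGen h

theorem cyclicStep_of_forall_mem {A B : Subgroup G} (hAB : A ≤ B)
    (hnorm : ∀ b ∈ B, ∀ a ∈ A, b * a * b⁻¹ ∈ A) {g : G} (hg : g ∈ B)
    (hgen : ∀ x ∈ B, ∃ k : ℤ, (g ^ k)⁻¹ * x ∈ A) : CyclicStep A B := by
  have hn : (A.subgroupOf B).Normal := ⟨fun a ha b => hnorm b b.2 a ha⟩
  refine ⟨hAB, hn, ⟨⟨QuotientGroup.mk ⟨g, hg⟩, fun x => ?_⟩⟩⟩
  induction x using QuotientGroup.induction_on with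
  | H x =>
    obtain ⟨k, hk⟩ := hgen x x.2
    exact ⟨k, QuotientGroup.eq.mpr hk⟩

theorem Subgroup.fg_of_moduleFinite {Q : Type*} [AddCommGroup Q] [Module.Finite ℤ Q]
    (H : Subgroup (Multiplicative Q)) : H.FG := by
  have h : (AddSubgroup.toIntSubmodule (Subgroup.toAddSubgroup' H)).FG := IsNoetherian.noetherian _
  rw [Submodule.fg_iff_addSubgroup_fg, AddSubgroup.fg_iff_mul_fg] at h
  exact h

/-- A homomorphism from `B` to a finitely generated abelian group, with kernel `A`, is filtered into
cyclic steps by the subgroups generated by initial segments of a list of generators of its range. -/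
theorem reflTransGen_cyclicStep_of_monoidHom {Q : Type*} [AddCommGroup Q] [Module.Finite ℤ Q]
    {A B : Subgroup G} (hAB : A ≤ B) (f : B →* Multiplicative Q)
    (hf : ∀ x : B, f x = 1 ↔ (x : G) ∈ A) : Relation.ReflTransGen CyclicStep A B := by
  classical
  obtain ⟨S, hS⟩ := Subgroup.fg_of_moduleFinite f.range
  have key : ∀ S : Finset (Multiplicative Q), (∀ s ∈ S, s ∈ f.range) →
      Relation.ReflTransGen CyclicStep A
        (((Subgroup.closure (S : Set (Multiplicative Q))).comap f).map B.subtype) := by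
    intro S
    induction S using Finset.induction_on with
    | empty =>
      intro _
      have h : ((Subgroup.closure ((∅ : Finset (Multiplicative Q)) : Set _)).comap f).map B.subtype
          = A := by
        ext x
        simp only [Finset.coe_empty, Subgroup.closure_empty, Subgroup.mem_map, Subgroup.mem_comap,
          Subgroup.mem_bot, hf, Subgroup.subtype_apply]
        exact ⟨fun ⟨y, hy, hxy⟩ => hxy ▸ hy, fun hx => ⟨⟨x, hAB hx⟩, hx, rfl⟩⟩
      rw [h]
    | insert q S _ ih =>
      intro hS
      refine (ih fun s hs => hS s (Finset.mem_insert_of_mem hs)).tail ?_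
      obtain ⟨b, rfl⟩ := hS q (Finset.mem_insert_self q S)
      have hle : Subgroup.closure (S : Set (Multiplicative Q)) ≤
          Subgroup.closure ((insert (f b) S : Finset _) : Set _) :=
        Subgroup.closure_mono (by simp)
      refine cyclicStep_of_forall_mem (g := b)
        (Subgroup.map_mono (Subgroup.comap_mono hle)) ?_ ?_ ?_
      · rintro _ ⟨y, -, rfl⟩ _ ⟨x, hx, rfl⟩
        refine ⟨y * x * y⁻¹, ?_, rfl⟩
        have h : f (y * x * y⁻¹) = f x := by
          rw [map_mul, map_mul, map_inv, mul_comm (f y), mul_inv_cancel_right]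
        rw [SetLike.mem_coe, Subgroup.mem_comap, h]
        exact hx
      · exact ⟨b, Subgroup.subset_closure (by simp), rfl⟩
      · rintro _ ⟨x, hx, rfl⟩
        rw [SetLike.mem_coe, Subgroup.mem_comap, Finset.coe_insert, Set.insert_eq,
          Subgroup.closure_union, Subgroup.mem_sup] at hx
        obtain ⟨y, hy, z, hz, hyz⟩ := hx
        obtain ⟨k, rfl⟩ := Subgroup.mem_closure_singleton.mp hy
        refine ⟨k, (b ^ k)⁻¹ * x, ?_, rfl⟩
        rw [SetLike.mem_coe, Subgroup.mem_comap, map_mul, map_inv, map_zpow, ← hyz,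
          inv_mul_cancel_left]
        exact hz
  have h := key S fun s hs => hS ▸ Subgroup.subset_closure hs
  have hB : ((Subgroup.closure (S : Set (Multiplicative Q))).comap f).map B.subtype = B := by
    rw [hS, show f.range.comap f = ⊤ from eq_top_iff.mpr fun x _ => ⟨x, rfl⟩,
      ← MonoidHom.range_eq_map, Subgroup.range_subtype]
  rwa [hB] at h

end Polycyclic

/-! ### Triangular groups of integral matrices -/

section Triangular

variable {σ K : Type*} [Field K]

/-- The matrices that are lower triangular for a weight `h`: an off-diagonal entry `(p, q)`
vanishes unless `h q < h p`. In particular the blocks of constant weight are diagonal. -/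
def weightTriangular [Fintype σ] [DecidableEq σ] (K : Type*) [Field K]
    (h : σ → ℤ) : Subalgebra ℤ (Matrix σ σ K) where
  carrier := {M | ∀ p q, p ≠ q → h p ≤ h q → M p q = 0}
  mul_mem' {M N} hM hN p q hpq hle := by
    rw [Matrix.mul_apply]
    refine Finset.sum_eq_zero fun r _ => ?_
    by_cases hpr : p = r
    · subst hpr
      rw [hN p q hpq hle, mul_zero]
    by_cases hrq : r = q
    · subst hrq
      rw [hM p r hpq hle, zero_mul]
    rcases le_or_gt (h p) (h r) with h1 | h1
    · rw [hM p r hpr h1, zero_mul]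
    · rw [hN r q hrq (h1.le.trans hle), mul_zero]
  add_mem' {M N} hM hN p q hpq hle := by
    rw [Matrix.add_apply, hM p q hpq hle, hN p q hpq hle, add_zero]
  algebraMap_mem' c p q hpq _ := by
    rw [Matrix.algebraMap_matrix_apply, if_neg hpq]

/-- The diagonal entries of triangular matrices multiply. -/
def weightTriangularDiag [Fintype σ] [DecidableEq σ] (h : σ → ℤ) (p : σ) :
    weightTriangular K h →ₐ[ℤ] K where
  toFun M := M.1 p p
  map_one' := Matrix.one_apply_eq p
  map_mul' M N := by
    change (M.1 * N.1) p p = _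
    rw [Matrix.mul_apply]
    refine Finset.sum_eq_single p (fun r _ hr => ?_) fun hp => absurd (Finset.mem_univ p) hp
    rcases le_total (h p) (h r) with h1 | h1
    · rw [M.2 p r hr.symm h1, zero_mul]
    · rw [N.2 r p hr h1, mul_zero]
  map_zero' := rfl
  map_add' _ _ := rfl
  commutes' c := by
    change algebraMap ℤ (Matrix σ σ K) c p p = _
    rw [Matrix.algebraMap_matrix_apply, if_pos rfl]

/-- The matrices whose non-zero entries raise the weight by at least `k`. -/
def weightFiltration (K : Type*) [Field K] (h : σ → ℤ) (k : ℕ) : AddSubgroup (Matrix σ σ K) where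
  carrier := {M | ∀ p q, h p < h q + k → M p q = 0}
  zero_mem' _ _ _ := rfl
  add_mem' {M N} hM hN p q hpq := by
    rw [Matrix.add_apply, hM p q hpq, hN p q hpq, add_zero]
  neg_mem' {M} hM p q hpq := by
    rw [Matrix.neg_apply, hM p q hpq, neg_zero]

theorem mul_mem_weightFiltration [Fintype σ] {h : σ → ℤ} {k l : ℕ} {M N : Matrix σ σ K}
    (hM : M ∈ weightFiltration K h k) (hN : N ∈ weightFiltration K h l) :
    M * N ∈ weightFiltration K h (k + l) := by
  intro p q hpq
  rw [Matrix.mul_apply]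
  refine Finset.sum_eq_zero fun r _ => ?_
  rcases lt_or_ge (h p) (h r + k) with h1 | h1
  · rw [hM p r h1, zero_mul]
  · rw [hN r q (by push_cast at hpq; omega), mul_zero]

theorem weightFiltration_anti {h : σ → ℤ} {k l : ℕ} (hkl : k ≤ l) :
    weightFiltration K h l ≤ weightFiltration K h k :=
  fun _ hM p q hpq => hM p q (by omega)

variable [Fintype σ] [DecidableEq σ]

theorem sub_one_mem_weightFiltration_zero {h : σ → ℤ} {M : Matrix σ σ K}
    (hM : M ∈ weightTriangular K h) : M - 1 ∈ weightFiltration K h 0 := by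
  intro p q hpq
  have hne : p ≠ q := by rintro rfl; simp at hpq
  rw [Matrix.sub_apply, hM p q hne (by simpa using hpq.le), Matrix.one_apply_ne hne, sub_zero]

variable {n : ℕ} {Γ : Subgroup (GL (Fin n) ℤ)} {Φ : Matrix (Fin n) (Fin n) ℤ →+* Matrix σ σ K}
  {h : σ → ℤ}

/-- The elements of a triangular group that are congruent to `1` modulo the `k`-th step of the
weight filtration. -/
def congruenceFiltration (htri : ∀ A ∈ Γ, Φ A.val ∈ weightTriangular K h) (k : ℕ) :
    Subgroup Γ where
  carrier := {A | Φ A.1.val - 1 ∈ weightFiltration K h k}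
  one_mem' := by
    simp only [Set.mem_ofPred_eq, OneMemClass.coe_one, Units.val_one, map_one, sub_self]
    exact zero_mem _
  mul_mem' {A B} hA hB := by
    have h1 : Φ (A * B).1.val - 1 = (Φ A.1.val - 1) * (Φ B.1.val - 1) + (Φ A.1.val - 1)
        + (Φ B.1.val - 1) := by
      rw [Subgroup.coe_mul, Units.val_mul, map_mul]
      noncomm_ring
    rw [Set.mem_ofPred_eq, h1]
    exact add_mem (add_mem (weightFiltration_anti (Nat.le_add_left k k)
      (mul_mem_weightFiltration hA hB)) hA) hB
  inv_mem' {A} hA := by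
    have h0 : Φ A.1.val * Φ A⁻¹.1.val = 1 := by
      rw [← map_mul, Subgroup.coe_inv, Units.mul_inv, map_one]
    have h1 : Φ A⁻¹.1.val - 1 = -((Φ A.1.val - 1) * (Φ A⁻¹.1.val - 1) + (Φ A.1.val - 1)) := by
      have : (Φ A.1.val - 1) * (Φ A⁻¹.1.val - 1) + (Φ A.1.val - 1)
          = Φ A.1.val * Φ A⁻¹.1.val - Φ A⁻¹.1.val := by noncomm_ring
      rw [this, h0, neg_sub]
    rw [Set.mem_ofPred_eq, h1]
    exact neg_mem (add_mem (mul_mem_weightFiltration hA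
      (sub_one_mem_weightFiltration_zero (htri _ A⁻¹.2))) hA)

theorem mem_congruenceFiltration (htri : ∀ A ∈ Γ, Φ A.val ∈ weightTriangular K h) {k : ℕ} {A : Γ} :
    A ∈ congruenceFiltration htri k ↔ Φ A.1.val - 1 ∈ weightFiltration K h k :=
  Iff.rfl

/-- For `k ≥ 1`, the quotient of consecutive terms of the congruence filtration embeds, by the
entries raising the weight by exactly `k`, in an additive quotient of the integral matrices. -/
theorem reflTransGen_congruenceFiltration_succ
    (htri : ∀ A ∈ Γ, Φ A.val ∈ weightTriangular K h) {k : ℕ} (hk : 1 ≤ k) :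
    Relation.ReflTransGen CyclicStep (congruenceFiltration htri (k + 1))
      (congruenceFiltration htri k) := by
  let gr : Matrix (Fin n) (Fin n) ℤ →+ Matrix σ σ K :=
    { toFun := fun M p q => if h p = h q + k then Φ M p q else 0
      map_zero' := by ext p q; simp
      map_add' := fun M N => by
        ext p q
        change _ = (if h p = h q + k then Φ M p q else 0) + if h p = h q + k then Φ N p q else 0
        split_ifs
        · rw [map_add]
          rfl
        · rw [add_zero] }
  have hgr : ∀ M p q, gr M p q = if h p = h q + k then Φ M p q else 0 := fun M p q => rfl
  let g : Matrix (Fin n) (Fin n) ℤ →ₗ[ℤ] Matrix σ σ K := gr.toIntLinearMap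
  let f : congruenceFiltration htri k →* Multiplicative (LinearMap.range g) :=
    { toFun := fun A => Multiplicative.ofAdd ⟨g (A.1.1.val - 1), _, rfl⟩
      map_one' := by
        rw [← ofAdd_zero]
        congr 1
        ext1
        simp
      map_mul' := fun A B => by
        rw [← ofAdd_add]
        congr 1
        ext1
        change gr ((A * B).1.1.val - 1) = gr (A.1.1.val - 1) + gr (B.1.1.val - 1)
        have h1 : (A * B).1.1.val - 1 = (A.1.1.val - 1) * (B.1.1.val - 1) + ((A.1.1.val - 1)
            + (B.1.1.val - 1)) := by
          rw [Subgroup.coe_mul, Subgroup.coe_mul, Units.val_mul]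
          noncomm_ring
        have h2 : gr ((A.1.1.val - 1) * (B.1.1.val - 1)) = 0 := by
          ext p q
          rw [hgr]
          split_ifs with hpq
          · rw [map_mul, map_sub, map_sub, map_one]
            exact mul_mem_weightFiltration A.2 B.2 p q (by push_cast; omega)
          · rfl
        rw [h1, map_add, map_add, h2, zero_add] }
  have hle : congruenceFiltration htri (k + 1) ≤ congruenceFiltration htri k :=
    fun A hA => weightFiltration_anti (Nat.le_succ k) hA
  refine reflTransGen_cyclicStep_of_monoidHom hle f fun A => ?_
  have h1 : f A = 1 ↔ gr (A.1.1.val - 1) = 0 := by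
    rw [← ofAdd_zero]
    exact Multiplicative.ofAdd.injective.eq_iff.trans Subtype.ext_iff
  rw [h1, mem_congruenceFiltration]
  refine ⟨fun h2 p q hpq => ?_, fun h2 => ?_⟩
  · rcases (show h p ≤ h q + k by push_cast at hpq; omega).lt_or_eq with h3 | h3
    · exact A.2 p q h3
    · have h4 := congrFun (congrFun h2 p) q
      rw [hgr, if_pos h3, map_sub, map_one] at h4
      exact h4
  · ext p q
    rw [hgr]
    split_ifs with h3
    · have h4 := h2 p q (by push_cast; omega)
      rwa [map_sub, map_one]
    · rfl

/-- The diagonal entries of an integral triangular group are units in the ring of integers of a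
number field, which form a finitely generated group by Dirichlet's unit theorem. -/
theorem reflTransGen_congruenceFiltration_zero [CharZero K] [Algebra.IsAlgebraic ℚ K]
    (htri : ∀ A ∈ Γ, Φ A.val ∈ weightTriangular K h) :
    Relation.ReflTransGen CyclicStep (congruenceFiltration htri 1)
      (congruenceFiltration htri 0) := by
  -- all entries of all `Φ M` lie in the number field generated by those of the elementary matrices
  let S : Set K := Set.range fun x : (Fin n × Fin n) × σ × σ =>
    Φ (Matrix.single x.1.1 x.1.2 1) x.2.1 x.2.2
  let F : IntermediateField ℚ K := IntermediateField.adjoin ℚ S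
  have hfin : FiniteDimensional ℚ F :=
    IntermediateField.finiteDimensional_adjoin fun x _ => Algebra.IsIntegral.isIntegral x
  have : NumberField F := ⟨⟩
  have hF : ∀ M p q, Φ M p q ∈ F := by
    intro M p q
    rw [Matrix.matrix_eq_sum_single M, map_sum, Matrix.sum_apply]
    refine sum_mem fun i _ => ?_
    rw [map_sum, Matrix.sum_apply]
    refine sum_mem fun j _ => ?_
    have h1 : Matrix.single i j (M i j) = M i j • Matrix.single i j (1 : ℤ) := by
      rw [Matrix.smul_single, smul_eq_mul, mul_one]
    rw [h1, map_zsmul, Matrix.smul_apply]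
    exact zsmul_mem (IntermediateField.subset_adjoin ℚ S ⟨((i, j), (p, q)), rfl⟩) _
  have hint : ∀ (A : Γ) p, IsIntegral ℤ (⟨Φ A.1.val p p, hF _ _ _⟩ : F) := by
    intro A p
    have h1 : IsIntegral ℤ (Φ A.1.val) := (Matrix.isIntegral A.1.val).map Φ.toIntAlgHom
    have h2 : IsIntegral ℤ (⟨Φ A.1.val, htri _ A.2⟩ : weightTriangular K h) :=
      (isIntegral_algHom_iff (weightTriangular K h).val Subtype.val_injective).mp h1
    have h3 : IsIntegral ℤ (Φ A.1.val p p) := h2.map (weightTriangularDiag h p)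
    exact (isIntegral_algHom_iff (F.val.toRingHom.toIntAlgHom) Subtype.val_injective).mp h3
  let χ : σ → Γ →* NumberField.RingOfIntegers F := fun p =>
    { toFun := fun A => ⟨⟨Φ A.1.val p p, hF _ _ _⟩, hint A p⟩
      map_one' := by
        apply Subtype.ext
        apply Subtype.ext
        change Φ 1 p p = 1
        rw [map_one, Matrix.one_apply_eq]
      map_mul' := fun A B => by
        apply Subtype.ext
        apply Subtype.ext
        have h1 := map_mul (weightTriangularDiag h p) ⟨Φ A.1.val, htri _ A.2⟩
          ⟨Φ B.1.val, htri _ B.2⟩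
        have h2 : Φ (A * B).1.val = Φ A.1.val * Φ B.1.val := by
          rw [Subgroup.coe_mul, Units.val_mul, map_mul]
        change Φ (A * B).1.val p p = Φ A.1.val p p * Φ B.1.val p p
        rw [h2]
        exact h1 }
  let f : congruenceFiltration htri 0 →*
      Multiplicative (σ → Additive (NumberField.RingOfIntegers F)ˣ) :=
    { toFun := fun A => Multiplicative.ofAdd fun p => Additive.ofMul ((χ p).toHomUnits A.1)
      map_one' := by
        rw [← ofAdd_zero]
        congr 1
        ext1 p
        rw [OneMemClass.coe_one, map_one]
        rfl
      map_mul' := fun A B => by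
        rw [← ofAdd_add]
        congr 1
        ext1 p
        rw [Subgroup.coe_mul, map_mul]
        rfl }
  have hle : congruenceFiltration htri 1 ≤ congruenceFiltration htri 0 :=
    fun A hA => weightFiltration_anti (Nat.zero_le 1) hA
  refine reflTransGen_cyclicStep_of_monoidHom hle f fun A => ?_
  have h1 : f A = 1 ↔ ∀ p, Φ A.1.1.val p p = 1 := by
    rw [← ofAdd_zero]
    refine (Multiplicative.ofAdd.injective.eq_iff.trans funext_iff).trans
      (forall_congr' fun p => ?_)
    refine (Additive.ofMul.injective.eq_iff (b := 1)).trans (Units.ext_iff.trans ?_)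
    exact Subtype.ext_iff.trans Subtype.ext_iff
  rw [h1, mem_congruenceFiltration]
  refine ⟨fun h2 p q hpq => ?_, fun h2 p => ?_⟩
  · by_cases hne : p = q
    · subst hne
      rw [Matrix.sub_apply, h2, Matrix.one_apply_eq, sub_self]
    · rw [Matrix.sub_apply, htri _ A.1.2 p q hne (by push_cast at hpq; omega),
        Matrix.one_apply_ne hne, sub_zero]
  · have h3 := h2 p p (by push_cast; omega)
    rwa [Matrix.sub_apply, Matrix.one_apply_eq, sub_eq_zero] at h3

/-- A group of integral matrices that becomes triangular over the algebraic numbers is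
polycyclic. -/
theorem isPolycyclic_of_weightTriangular [CharZero K] [Algebra.IsAlgebraic ℚ K]
    (hΦ : Function.Injective Φ) (htri : ∀ A ∈ Γ, Φ A.val ∈ weightTriangular K h) :
    IsPolycyclic Γ := by
  refine isPolycyclic_of_reflTransGen ?_
  have htop : congruenceFiltration htri 0 = ⊤ :=
    eq_top_iff.mpr fun A _ => sub_one_mem_weightFiltration_zero (htri _ A.2)
  obtain ⟨m, hm⟩ : ∃ m : ℕ, ∀ p q, h p < h q + m := by
    obtain ⟨b, hb⟩ := (Set.finite_range fun x : σ × σ => h x.1 - h x.2).bddAbove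
    refine ⟨b.toNat + 1, fun p q => ?_⟩
    have h1 : h p - h q ≤ b := hb ⟨(p, q), rfl⟩
    push_cast
    have := Int.self_le_toNat b
    omega
  have hbot : congruenceFiltration htri (m + 1) = ⊥ := by
    refine eq_bot_iff.mpr fun A hA => Subgroup.mem_bot.mpr (Subtype.ext (Units.ext (hΦ ?_)))
    rw [OneMemClass.coe_one, Units.val_one, map_one, ← sub_eq_zero]
    ext p q
    exact hA p q ((hm p q).trans (by push_cast; omega))
  have hchain : ∀ m : ℕ, Relation.ReflTransGen CyclicStep (congruenceFiltration htri (m + 1))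
      (congruenceFiltration htri 0) := by
    intro m
    induction m with
    | zero => exact reflTransGen_congruenceFiltration_zero htri
    | succ m ih => exact (reflTransGen_congruenceFiltration_succ htri (Nat.succ_pos m)).trans ih
  rw [← htop, ← hbot]
  exact hchain m

end Triangular

/-! ### The centralizer for blocks of different sizes -/

theorem HasSeveralDistinctJordanBlocks.isPolycyclic {n : ℕ} {T : GL (Fin n) ℚ}
    (hT : HasSeveralDistinctJordanBlocks T) : IsPolycyclic (integralCentralizer T) := by
  obtain ⟨k, eig, size, hJ, hsize, -⟩ := hT
  obtain ⟨Φ, hinj, hcomm⟩ := hJ.exists_injective_ringHom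
  -- the two `ℚ`-algebra structures on the algebraic closure agree
  have hrat : (DivisionRing.toRatAlgebra : Algebra ℚ (AlgebraicClosure ℚ)) =
      AlgebraicClosure.instAlgebra ℚ := Subsingleton.elim _ _
  have : Algebra.IsAlgebraic ℚ (AlgebraicClosure ℚ) := by
    rw [hrat]
    exact AlgebraicClosure.isAlgebraic ℚ
  exact isPolycyclic_of_weightTriangular (h := fun p => (size p.1 : ℤ) - 2 * (p.2 : ℕ)) hinj
    fun A hA p q hpq hle => apply_eq_zero_of_commute (hcomm A hA) hsize hpq hle

theorem theorem1 (n : ℕ) (T : GL (Fin n) ℚ) :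
    (HasUniqueJordanBlocks T →
      ∀ A ∈ integralCentralizer T, ∀ B ∈ integralCentralizer T, A * B = B * A) ∧
    (HasTwoEqualJordanBlocks T →
      ∃ f : FreeGroup (Fin 2) →* integralCentralizer T, Function.Injective f) ∧
    (HasSeveralDistinctJordanBlocks T → IsPolycyclic (integralCentralizer T)) :=
  ⟨fun hT _ hA _ hB => hT.mul_comm_of_mem hA hB, fun hT => hT.exists_injective_freeGroup,
    fun hT => hT.isPolycyclic⟩
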